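/- **Definitions.** Let $G=(V,E)$ be a finite graph and $\omega:V\to\{0,1\}$ a charging with $\sum_{v}\omega(v)\equiv 1 \pmod 2$ (an odd charging). The Tseitin contradiction $TS(G,\omega)$ is the set of integer linear inequalities, in the variables $x_e$ ($e\in E$), consisting of $0\le x_e\le 1$ for every edge $e$ and of the translation of the CNF encoding of the constraints $\sum_{e\ni v}x_e\equiv\omega(v)\pmod 2$ ($v\in V$): for each $v$ and each set $A$ of edges at $v$ with $|A|\not\equiv\omega(v)\pmod 2$, the inequality $$\sum_{e\ni v,\ e\notin A}x_e+\sum_{e\in A}(1-x_e)\ \ge\ 1 .$$ A Stabbing Planes refutation of a set $\mathcal F$ of integer linear inequalities in variables $x$ is a finite binary tree $\mathcal T$. Each inner node is labelled with a query $(\mathbf a,b)$, where $\mathbf a$ is an integer vector and $b$ an integer; one of its two outgoing edges is labelled $\mathbf a x\ge b$, the other $\mathbf a x\le b-1$. Each leaf is labelled with a finite system of linear inequalities, each of which is a nonnegative linear combination of inequalities from $\mathcal F$ and the inequalities labelling the path from the root to this leaf; and each of these systems has no real solution. The length $|\mathcal T|$ is the number of queries (inner nodes) of the tree, and its depth is the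 number of edges of a longest root-to-leaf path. **Theorem.** Let $H_n$ be the $n\times n$ grid graph. There are a constant $c>0$ and an $n_0$ such that for all $n\ge n_0$ and every odd charging $\omega$ of $H_n$, every Stabbing Planes refutation $\mathcal T$ of $TS(H_n,\omega)$ satisfies $$|\mathcal T|\ \ge\ c\,n^{1.04}.$$ Moreover there are a constant $c'>0$ and an $n_0'$ such that for all $n\ge n_0'$ and every odd charging $\omega$ of $H_n$, every Stabbing Planes refutation of $TS(H_n,\omega)$ has depth at least $c'\log n$. -/

import Mathlib

open Filter

/-- The linear inequality `∑ i, coeff i * x i ≥ bound` in the variables `x i`, `i : ι`. -/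
structure LinIneq (ι R : Type*) where
  coeff : ι → R
  bound : R

namespace LinIneq

variable {ι : Type*}

/-- An integer linear inequality, seen as a real one. -/
def toReal (q : LinIneq ι ℤ) : LinIneq ι ℝ where
  coeff i := (q.coeff i : ℝ)
  bound := (q.bound : ℝ)

/-- The real point `x` satisfies the inequality. -/
def Holds [Fintype ι] (q : LinIneq ι ℝ) (x : ι → ℝ) : Prop :=
  q.bound ≤ ∑ i, q.coeff i * x i

/-- `q` is a (finite) linear combination, with nonnegative real weights, of inequalities from `S`. -/
def IsNonnegComb (S : Set (LinIneq ι ℝ)) (q : LinIneq ι ℝ) : Prop :=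
  ∃ w : LinIneq ι ℝ →₀ ℝ,
    (∀ p ∈ w.support, p ∈ S) ∧ (∀ p, 0 ≤ w p) ∧
    (∀ i, q.coeff i = w.sum fun p c => c * p.coeff i) ∧
    q.bound = w.sum fun p c => c * p.bound

/-- For the query `q = (a, b)`, standing for `a x ≥ b`, the integer negation `a x ≤ b - 1`,
written as `(-a) x ≥ 1 - b`. -/
def integerNegation (q : LinIneq ι ℤ) : LinIneq ι ℤ where
  coeff i := -q.coeff i
  bound := 1 - q.bound

end LinIneq

/-- Binary trees underlying Stabbing Planes proofs. An inner node carries a query `(a, b)`;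
its subtrees `geq`, `leq` are reached by the edges labelled `a x ≥ b` and `a x ≤ b - 1`.
A leaf carries an LP, that is, a finite system of real linear inequalities. -/
inductive SPTree (ι : Type*) where
  | leaf (P : List (LinIneq ι ℝ)) : SPTree ι
  | node (query : LinIneq ι ℤ) (geq leq : SPTree ι) : SPTree ι

namespace SPTree

variable {ι : Type*}

/-- The number of queries in the tree. -/
def length : SPTree ι → ℕ
  | leaf _ => 0
  | node _ T₁ T₂ => T₁.length + T₂.length + 1

/-- The length (number of edges) of a longest path from the root to a leaf. -/
def depth : SPTree ι → ℕ
  | leaf _ => 0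
  | node _ T₁ T₂ => max T₁.depth T₂.depth + 1

/-- `T` is a Stabbing Planes proof of `F`: the LP at each leaf consists of nonnegative linear
combinations of inequalities from `F` and the inequalities labelling the path to that leaf.
(In the recursion, the path labels are added to `F`.) -/
def IsProof : Set (LinIneq ι ℤ) → SPTree ι → Prop
  | F, leaf P => ∀ p ∈ P, LinIneq.IsNonnegComb (LinIneq.toReal '' F) p
  | F, node q T₁ T₂ => IsProof (insert q F) T₁ ∧ IsProof (insert q.integerNegation F) T₂

/-- The LP at each leaf has no real solution. -/
def LeavesInfeasible [Fintype ι] : SPTree ι → Prop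
  | leaf P => ¬ ∃ x : ι → ℝ, ∀ p ∈ P, p.Holds x
  | node _ T₁ T₂ => T₁.LeavesInfeasible ∧ T₂.LeavesInfeasible

/-- `T` is a Stabbing Planes refutation of `F`. -/
def IsRefutation [Fintype ι] (F : Set (LinIneq ι ℤ)) (T : SPTree ι) : Prop :=
  T.IsProof F ∧ T.LeavesInfeasible

end SPTree

/-- The clause `(⋁ i ∈ pos, x i) ∨ (⋁ i ∈ neg, ¬ x i)`. -/
structure Clause (ι : Type*) where
  pos : Finset ι
  neg : Finset ι

/-- The clause as the inequality `∑ i ∈ pos, x i + ∑ i ∈ neg, (1 - x i) ≥ 1`, that is,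
`∑ i ∈ pos, x i - ∑ i ∈ neg, x i ≥ 1 - |neg|`. -/
def Clause.toIneq {ι : Type*} [DecidableEq ι] (C : Clause ι) : LinIneq ι ℤ where
  coeff i := (if i ∈ C.pos then 1 else 0) - (if i ∈ C.neg then 1 else 0)
  bound := 1 - (C.neg.card : ℤ)

/-- The inequalities `x i ≥ 0` and `-x i ≥ -1`, for all variables. -/
def booleanAxioms (ι : Type*) [DecidableEq ι] : Set (LinIneq ι ℤ) :=
  {q | ∃ i, q = ⟨Pi.single i 1, 0⟩ ∨ q = ⟨Pi.single i (-1), -1⟩}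

/-- The integer linear inequalities that translate a CNF: those of its clauses, and `0 ≤ x ≤ 1`
for each variable. -/
def cnfIneqs {ι : Type*} [DecidableEq ι] (𝒞 : Set (Clause ι)) : Set (LinIneq ι ℤ) :=
  Clause.toIneq '' 𝒞 ∪ booleanAxioms ι

/-- The CNF encoding of the constraints `∑_{e ∋ v} x_e = ω v (mod 2)`, for all vertices `v`; its
variables are the edges. For each `v` there is one clause for each assignment to the edges at `v`
with the wrong parity: if `A` is the set of edges at `v` which are assigned `1`, the clause that
excludes the assignment has `neg = A`, and `pos` is the set of the other edges at `v`. -/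
def tseitinCNF {V : Type*} (G : SimpleGraph V) (ω : V → ZMod 2) : Set (Clause G.edgeSet) :=
  {C | ∃ v : V, (∀ e : G.edgeSet, (e ∈ C.pos ∨ e ∈ C.neg) ↔ v ∈ (e : Sym2 V)) ∧
    Disjoint C.pos C.neg ∧ (C.neg.card : ZMod 2) ≠ ω v}

/-- The Tseitin contradiction `TS(G, ω)`, as a set of integer linear inequalities. -/
def tseitin {V : Type*} [DecidableEq V] (G : SimpleGraph V) (ω : V → ZMod 2) :
    Set (LinIneq G.edgeSet ℤ) :=
  cnfIneqs (tseitinCNF G ω)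

/-- The `n × n` grid graph. -/
def gridGraph (n : ℕ) : SimpleGraph (Fin n × Fin n) :=
  (SimpleGraph.pathGraph n).boxProd (SimpleGraph.pathGraph n)

noncomputable instance (n : ℕ) : Fintype (gridGraph n).edgeSet :=
  Fintype.ofFinite _

/-!
The argument is linear algebra over `ZMod 2`. Let `T` be a refutation with queries `(aⱼ, bⱼ)`. If a
real point `x` satisfies `TS(G, ω)` and every `aⱼ x` is an integer, then `x` satisfies one of the
two labels below each query, so it follows a path to a leaf and satisfies the system there, which
is impossible (`SPTree.not_isRefutation_of_forall_query_integral`).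

Such a point exists whenever `T` has fewer than `|E| - |V|` queries. By a dimension count there is a
nonzero vector `H` over `ZMod 2`, indexed by the edges, which has even degree at every vertex and
satisfies `⟨aⱼ, H⟩ = 0` in `ZMod 2` for all `j`. Put `x = 1/2` on the support of `H`. Elsewhere let
`x` be a `0/1` assignment that has the prescribed parity at every vertex except perhaps one vertex
on `H`; it exists because `G` is connected. Then `aⱼ x` is an integer since the half-integral edges
contribute half of an even number. A vertex on `H` has at least two edges with value `1/2`, which
already satisfy each of its clauses; every other vertex sees a `0/1` assignment of the right parity.

Hence `|E| ≤ |V| + |T|` for every connected graph (`card_edgeSet_le_card_add_length`). For the grid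
this gives `|T| ≥ n² - 2n`, which is more than both bounds require, since `|T| < 2 ^ depth T`.
-/

/-! ### Points that follow a path of the tree -/

/-- A nonnegative combination of inequalities holds at every point where these hold. -/
theorem LinIneq.IsNonnegComb.holds {ι : Type*} [Fintype ι] {S : Set (LinIneq ι ℝ)}
    {q : LinIneq ι ℝ} (h : q.IsNonnegComb S) {x : ι → ℝ} (hx : ∀ p ∈ S, p.Holds x) :
    q.Holds x := by
  obtain ⟨w, hwS, hw0, hc, hb⟩ := h
  have h1 : ∑ i, q.coeff i * x i = w.sum fun p c => c * ∑ i, p.coeff i * x i := by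
    simp only [hc, Finsupp.sum, Finset.sum_mul, Finset.mul_sum]
    rw [Finset.sum_comm]
    simp only [mul_assoc]
  unfold LinIneq.Holds
  rw [h1, hb]
  exact Finset.sum_le_sum fun p hp => mul_le_mul_of_nonneg_left (hx p (hwS p hp)) (hw0 p)

namespace SPTree

variable {ι : Type*}

/-- The list of all queries in the tree. -/
def queries : SPTree ι → List (LinIneq ι ℤ)
  | leaf _ => []
  | node q T₁ T₂ => q :: (T₁.queries ++ T₂.queries)

theorem length_queries (T : SPTree ι) : T.queries.length = T.length := by
  induction T with
  | leaf P => rfl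
  | node q T₁ T₂ h₁ h₂ => simp [queries, length, h₁, h₂]

theorem length_lt_two_pow_depth (T : SPTree ι) : T.length < 2 ^ T.depth := by
  induction T with
  | leaf P => simp [length, depth]
  | node q T₁ T₂ h₁ h₂ =>
    have e₁ : 2 ^ T₁.depth ≤ 2 ^ max T₁.depth T₂.depth :=
      Nat.pow_le_pow_right two_pos (le_max_left _ _)
    have e₂ : 2 ^ T₂.depth ≤ 2 ^ max T₁.depth T₂.depth :=
      Nat.pow_le_pow_right two_pos (le_max_right _ _)
    simp only [length, depth, pow_succ]
    omega

/-- A solution of `F` at which all query forms take integer values lies in none of the slabs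
`b - 1 < a x < b` cut out by the queries, so it reaches a leaf. -/
theorem not_isRefutation_of_forall_query_integral [Fintype ι] {F : Set (LinIneq ι ℤ)}
    {T : SPTree ι} {x : ι → ℝ} (hF : ∀ q ∈ F, q.toReal.Holds x)
    (hint : ∀ q ∈ T.queries, ∃ z : ℤ, ∑ i, (q.coeff i : ℝ) * x i = z) :
    ¬ T.IsRefutation F := by
  induction T generalizing F with
  | leaf P =>
    rintro ⟨hP, hL⟩
    refine hL ⟨x, fun p hp => (hP p hp).holds ?_⟩
    rintro _ ⟨q, hq, rfl⟩
    exact hF q hq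
  | node q T₁ T₂ ih₁ ih₂ =>
    rintro ⟨⟨hP₁, hP₂⟩, hL₁, hL₂⟩
    obtain ⟨z, hz⟩ := hint q (by simp [queries])
    rcases le_or_gt q.bound z with h | h
    · refine ih₁ (F := insert q F) ?_ (fun p hp => hint p (by simp [queries, hp])) ⟨hP₁, hL₁⟩
      rintro p (rfl | hp)
      · simp only [LinIneq.Holds, LinIneq.toReal, hz]
        exact_mod_cast h
      · exact hF p hp
    · refine ih₂ (F := insert q.integerNegation F) ?_
        (fun p hp => hint p (by simp [queries, hp])) ⟨hP₂, hL₂⟩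
      rintro p (rfl | hp)
      · simp only [LinIneq.Holds, LinIneq.toReal, LinIneq.integerNegation, Int.cast_neg, neg_mul,
          Finset.sum_neg_distrib, hz]
        have : 1 - q.bound ≤ -z := by omega
        exact_mod_cast this
      · exact hF p hp

end SPTree

/-! ### Edge vectors modulo two -/

section Boundary

variable {V : Type*} [DecidableEq V] (G : SimpleGraph V) [Fintype G.edgeSet]

/-- The boundary map of the graph modulo two: it sends an edge vector `y` to the function
`v ↦ ∑_{e ∋ v} y e`. Its kernel is the cycle space of `G`. -/
def edgeBoundary : (G.edgeSet → ZMod 2) →ₗ[ZMod 2] (V → ZMod 2) where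
  toFun y v := ∑ e : G.edgeSet, if v ∈ (e : Sym2 V) then y e else 0
  map_add' y z := by
    ext v
    simp only [Pi.add_apply, ← Finset.sum_add_distrib]
    refine Finset.sum_congr rfl fun e _ => ?_
    split_ifs <;> simp
  map_smul' c y := by
    ext v
    simp [Finset.mul_sum]

variable {G}

theorem edgeBoundary_apply (y : G.edgeSet → ZMod 2) (v : V) :
    edgeBoundary G y v = ∑ e : G.edgeSet, if v ∈ (e : Sym2 V) then y e else 0 := rfl

theorem edgeBoundary_single {u v : V} (h : G.Adj u v) :
    edgeBoundary G (Pi.single ⟨s(u, v), h⟩ 1) = Pi.single u 1 + Pi.single v 1 := by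
  classical
  ext w
  rw [edgeBoundary_apply, Finset.sum_eq_single ⟨s(u, v), h⟩]
  · have hne := h.ne
    by_cases h1 : w = u
    · subst h1
      simp [hne]
    · by_cases h2 : w = v
      · subst h2
        simp [h1]
      · simp [h1, h2]
  · intro e _ he
    simp [he]
  · simp

theorem single_add_single_mem_range_edgeBoundary {u v : V} (h : G.Reachable u v) :
    (Pi.single u 1 + Pi.single v 1 : V → ZMod 2) ∈ LinearMap.range (edgeBoundary G) := by
  have hself (f : V → ZMod 2) : f + f = 0 := funext fun v => CharTwo.add_self_eq_zero (f v)
  obtain ⟨p⟩ := h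
  induction p with
  | nil =>
    rw [hself]
    exact Submodule.zero_mem _
  | @cons u v w hadj p ih =>
    have h1 : (Pi.single u 1 + Pi.single v 1 : V → ZMod 2) ∈ LinearMap.range (edgeBoundary G) :=
      ⟨_, edgeBoundary_single hadj⟩
    have h2 := Submodule.add_mem _ h1 ih
    rwa [add_assoc, ← add_assoc (Pi.single v 1), hself, zero_add] at h2

/-- In a connected graph every parity constraint can be met at all vertices but one. -/
theorem exists_edgeBoundary_eq_of_ne [Fintype V] (hG : G.Preconnected) (ω : V → ZMod 2)
    (v₀ : V) : ∃ y, ∀ v ≠ v₀, edgeBoundary G y v = ω v := by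
  have h : ∑ u, ω u • (Pi.single u 1 + Pi.single v₀ 1 : V → ZMod 2) ∈
      LinearMap.range (edgeBoundary G) :=
    Submodule.sum_mem _ fun u _ =>
      Submodule.smul_mem _ _ (single_add_single_mem_range_edgeBoundary (hG u v₀))
  obtain ⟨y, hy⟩ := h
  refine ⟨y, fun v hv => ?_⟩
  rw [hy]
  simp [Finset.sum_apply, hv, Pi.single_apply]

/-- A dimension count: a nonzero element of the cycle space that is orthogonal modulo two to all
coefficient vectors in the list. -/
theorem exists_cycle_orthogonal [Fintype V] (L : List (LinIneq G.edgeSet ℤ))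
    (hL : Fintype.card V + L.length < Fintype.card G.edgeSet) :
    ∃ H : G.edgeSet → ZMod 2, H ≠ 0 ∧ edgeBoundary G H = 0 ∧
      ∀ q ∈ L, ∑ e, (q.coeff e : ZMod 2) * H e = 0 := by
  let f : (G.edgeSet → ZMod 2) →ₗ[ZMod 2] (Fin L.length → ZMod 2) :=
    Matrix.mulVecLin (Matrix.of fun j e => ((L.get j).coeff e : ZMod 2))
  have hker : LinearMap.ker ((edgeBoundary G).prod f) ≠ ⊥ :=
    LinearMap.ker_ne_bot_of_finrank_lt (by simpa using hL)
  obtain ⟨H, hH, hne⟩ := Submodule.exists_mem_ne_zero_of_ne_bot hker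
  have hH' : edgeBoundary G H = 0 ∧ f H = 0 := by simpa using hH
  refine ⟨H, hne, hH'.1, fun q hq => ?_⟩
  obtain ⟨j, rfl⟩ := List.get_of_mem hq
  exact congrFun hH'.2 j

end Boundary

/-! ### Half-integral solutions of the Tseitin inequalities -/

/-- The value at `x` of the literal of `C` on the variable `i`, and zero if `C` has no such
literal. -/
def Clause.litValue {ι : Type*} [DecidableEq ι] (C : Clause ι) (x : ι → ℝ) (i : ι) : ℝ :=
  if i ∈ C.pos then x i else if i ∈ C.neg then 1 - x i else 0

theorem Clause.holds_toIneq {ι : Type*} [DecidableEq ι] [Fintype ι] {C : Clause ι}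
    (hC : Disjoint C.pos C.neg) {x : ι → ℝ} (h : 1 ≤ ∑ i, C.litValue x i) :
    C.toIneq.toReal.Holds x := by
  have h1 : ∑ i, C.litValue x i = ∑ i, ((C.toIneq.toReal.coeff i) * x i +
      if i ∈ C.neg then 1 else 0) := by
    refine Finset.sum_congr rfl fun i _ => ?_
    by_cases hp : i ∈ C.pos
    · simp [Clause.litValue, Clause.toIneq, LinIneq.toReal, hp, Finset.disjoint_left.1 hC hp]
    · by_cases hn : i ∈ C.neg <;>
        simp [Clause.litValue, Clause.toIneq, LinIneq.toReal, hp, hn]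
      ring
  rw [h1, Finset.sum_add_distrib, Finset.sum_boole] at h
  have h2 : (C.toIneq.toReal.bound : ℝ) = 1 - C.neg.card := by
    simp [Clause.toIneq, LinIneq.toReal]
  rw [Finset.filter_univ_mem] at h
  rw [LinIneq.Holds, h2]
  linarith

/-- The point with value `1/2` on the support of `H` and value `y` elsewhere. -/
noncomputable def halfPoint {ι : Type*} (H y : ι → ZMod 2) (i : ι) : ℝ :=
  if H i = 0 then ((y i).val : ℝ) else 1 / 2

theorem halfPoint_mem_Icc {ι : Type*} (H y : ι → ZMod 2) (i : ι) :
    halfPoint H y i ∈ Set.Icc (0 : ℝ) 1 := by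
  unfold halfPoint
  split_ifs
  · have : (y i).val ≤ 1 := Nat.lt_succ_iff.1 (ZMod.val_lt (y i))
    exact ⟨Nat.cast_nonneg _, by exact_mod_cast this⟩
  · norm_num

theorem sum_mul_halfPoint_integral {ι : Type*} [Fintype ι] {H : ι → ZMod 2} (y : ι → ZMod 2)
    {a : ι → ℤ} (ha : ∑ i, (a i : ZMod 2) * H i = 0) :
    ∃ z : ℤ, ∑ i, (a i : ℝ) * halfPoint H y i = z := by
  have hdvd : (2 : ℤ) ∣ ∑ i, a i * ((H i).val : ℤ) := by
    rw [← Nat.cast_ofNat, ← ZMod.intCast_zmod_eq_zero_iff_dvd]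
    push_cast
    simpa using ha
  obtain ⟨m, hm⟩ := hdvd
  refine ⟨m + ∑ i, a i * (if H i = 0 then ((y i).val : ℤ) else 0), ?_⟩
  have hm' : (∑ i, (a i : ℝ) * ((H i).val : ℝ)) = 2 * m := by exact_mod_cast hm
  have hm'' : (m : ℝ) = ∑ i, (a i : ℝ) * ((H i).val : ℝ) / 2 := by
    rw [← Finset.sum_div, hm']
    ring
  push_cast
  rw [hm'', ← Finset.sum_add_distrib]
  refine Finset.sum_congr rfl fun i _ => ?_
  unfold halfPoint
  by_cases h : H i = 0
  · simp [h]
  · have h1 : H i = 1 := Fin.eq_one_of_ne_zero _ h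
    simp [h1, ZMod.val_one]
    ring

/-- The half-integral point given by a cycle `H` and an assignment `y` satisfies all inequalities of
`TS(G, ω)` if `y` has the right parity at the vertices off `H`. -/
theorem halfPoint_holds_tseitin {V : Type*} [DecidableEq V] {G : SimpleGraph V}
    [Fintype G.edgeSet] {ω : V → ZMod 2} {H y : G.edgeSet → ZMod 2}
    (hH : edgeBoundary G H = 0)
    (hy : ∀ v, (∀ e : G.edgeSet, v ∈ (e : Sym2 V) → H e = 0) → edgeBoundary G y v = ω v) :
    ∀ q ∈ tseitin G ω, q.toReal.Holds (halfPoint H y) := by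
  classical
  have hIcc := halfPoint_mem_Icc H y
  rintro q (⟨C, ⟨v, hv, hdisj, hpar⟩, rfl⟩ | ⟨e, rfl | rfl⟩)
  · refine Clause.holds_toIneq hdisj ?_
    have hnn : ∀ e, 0 ≤ C.litValue (halfPoint H y) e := by
      intro e
      have := hIcc e
      unfold Clause.litValue
      split_ifs <;> linarith [this.1, this.2]
    by_cases hvH : ∀ e : G.edgeSet, v ∈ (e : Sym2 V) → H e = 0
    · -- If no literal is true, then `y` is the indicator of `C.neg` at `v`: wrong parity.
      by_contra hlt
      have hlit : ∀ e, C.litValue (halfPoint H y) e < 1 := fun e =>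
        (Finset.single_le_sum (fun i _ => hnn i) (Finset.mem_univ e)).trans_lt (not_le.1 hlt)
      refine hpar ?_
      rw [← hy v hvH, edgeBoundary_apply, Finset.card_eq_sum_ones, Nat.cast_sum]
      rw [← Finset.sum_filter_add_sum_filter_not Finset.univ (fun e => e ∈ C.neg)]
      rw [Finset.sum_eq_zero (s := Finset.univ.filter fun e => ¬ e ∈ C.neg), add_zero,
        Finset.filter_univ_mem]
      · refine Finset.sum_congr rfl fun e he => ?_
        have hev : v ∈ (e : Sym2 V) := (hv e).1 (Or.inr he)
        have h1 := hlit e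
        rw [Clause.litValue, if_neg (Finset.disjoint_right.1 hdisj he), if_pos he, halfPoint,
          if_pos (hvH e hev)] at h1
        rw [if_pos hev]
        have h2 : y e ≠ 0 := by
          intro h0
          norm_num [h0] at h1
        have h3 : y e = 1 := Fin.eq_one_of_ne_zero _ h2
        rw [h3, Nat.cast_one]
      · intro e he
        have hen : e ∉ C.neg := (Finset.mem_filter.1 he).2
        by_cases hev : v ∈ (e : Sym2 V)
        · have hep : e ∈ C.pos := ((hv e).2 hev).resolve_right hen
          have h1 := hlit e
          rw [Clause.litValue, if_pos hep, halfPoint, if_pos (hvH e hev)] at h1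
          have h2 : (y e).val < 1 := by exact_mod_cast h1
          rw [if_pos hev]
          exact (ZMod.val_eq_zero _).1 (by omega)
        · rw [if_neg hev]
    · push Not at hvH
      obtain ⟨e, hev, heH⟩ := hvH
      -- Since `H` has even degree at `v`, there is a second half-integral edge.
      obtain ⟨e', hne, hev', heH'⟩ : ∃ e' : G.edgeSet, e' ≠ e ∧ v ∈ (e' : Sym2 V) ∧ H e' ≠ 0 := by
        by_contra! hcon
        have h0 := congrFun hH v
        rw [edgeBoundary_apply, Finset.sum_eq_single e, if_pos hev] at h0
        · exact heH h0
        · intro e' _ hne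
          split_ifs with h
          · exact hcon e' hne h
          · rfl
        · simp
      have hhalf : ∀ e : G.edgeSet, v ∈ (e : Sym2 V) → H e ≠ 0 →
          C.litValue (halfPoint H y) e = 1 / 2 := by
        intro e hev heH
        unfold Clause.litValue halfPoint
        rcases (hv e).2 hev with h | h
        · rw [if_pos h, if_neg heH]
        · rw [if_neg (Finset.disjoint_right.1 hdisj h), if_pos h, if_neg heH]
          norm_num
      calc (1 : ℝ) = ∑ i ∈ {e', e}, C.litValue (halfPoint H y) i := by
            rw [Finset.sum_pair hne, hhalf e hev heH, hhalf e' hev' heH']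
            norm_num
        _ ≤ _ := Finset.sum_le_univ_sum_of_nonneg hnn
  · simpa [LinIneq.Holds, LinIneq.toReal, Pi.single_apply] using (hIcc e).1
  · simpa [LinIneq.Holds, LinIneq.toReal, Pi.single_apply] using (hIcc e).2

/-- In a connected graph, a Stabbing Planes refutation of a Tseitin contradiction needs at least
`|E| - |V|` queries. -/
theorem card_edgeSet_le_card_add_length {V : Type*} [Fintype V] [DecidableEq V]
    {G : SimpleGraph V} [Fintype G.edgeSet] (hG : G.Preconnected) {ω : V → ZMod 2}
    {T : SPTree G.edgeSet} (hT : T.IsRefutation (tseitin G ω)) :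
    Fintype.card G.edgeSet ≤ Fintype.card V + T.length := by
  by_contra! hlt
  rw [← T.length_queries] at hlt
  obtain ⟨H, hH0, hH, hq⟩ := exists_cycle_orthogonal T.queries hlt
  obtain ⟨e, he⟩ := Function.ne_iff.1 hH0
  obtain ⟨v₀, hv₀⟩ : ∃ v₀, v₀ ∈ (e : Sym2 V) := ⟨_, Sym2.out_fst_mem (e : Sym2 V)⟩
  obtain ⟨y, hy⟩ := exists_edgeBoundary_eq_of_ne hG ω v₀
  refine SPTree.not_isRefutation_of_forall_query_integral (x := halfPoint H y)
    (halfPoint_holds_tseitin hH fun v hv => hy v ?_)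
    (fun q h => sum_mul_halfPoint_integral y (hq q h)) hT
  rintro rfl
  exact he (hv e hv₀)

/-! ### The grid -/

theorem gridGraph_preconnected (n : ℕ) : (gridGraph n).Preconnected :=
  (SimpleGraph.pathGraph_preconnected n).boxProd (SimpleGraph.pathGraph_preconnected n)

theorem two_mul_le_card_edgeSet_gridGraph (m : ℕ) :
    2 * (m * (m + 1)) ≤ Fintype.card (gridGraph (m + 1)).edgeSet := by
  let f : Fin m × Fin (m + 1) ⊕ Fin m × Fin (m + 1) → (gridGraph (m + 1)).edgeSet :=
    Sum.elim
      (fun p => ⟨s((p.1.castSucc, p.2), (p.1.succ, p.2)), by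
        simp [gridGraph, SimpleGraph.boxProd_adj, SimpleGraph.pathGraph_adj]⟩)
      (fun p => ⟨s((p.2, p.1.castSucc), (p.2, p.1.succ)), by
        simp [gridGraph, SimpleGraph.boxProd_adj, SimpleGraph.pathGraph_adj]⟩)
  have hf : Function.Injective f := by
    rintro (⟨i, j⟩ | ⟨i, j⟩) (⟨i', j'⟩ | ⟨i', j'⟩) h <;>
      have h' := congrArg Subtype.val h <;>
      simp [f, Fin.ext_iff] at h' ⊢ <;> omega
  have := Fintype.card_le_of_injective f hf
  simp only [Fintype.card_sum, Fintype.card_prod, Fintype.card_fin] at this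
  omega

theorem sq_le_length_add_two_mul {n : ℕ} {ω : Fin n × Fin n → ZMod 2}
    {T : SPTree (gridGraph n).edgeSet} (hT : T.IsRefutation (tseitin (gridGraph n) ω)) :
    n ^ 2 ≤ T.length + 2 * n := by
  have h := card_edgeSet_le_card_add_length (gridGraph_preconnected n) hT
  rcases n with _ | m
  · simp
  · have h2 := two_mul_le_card_edgeSet_gridGraph m
    simp only [Fintype.card_prod, Fintype.card_fin] at h
    nlinarith

theorem mainTheorem1 :
    (∃ c : ℝ, 0 < c ∧ ∀ᶠ n : ℕ in atTop,
      ∀ ω : Fin n × Fin n → ZMod 2, ∑ v, ω v = 1 →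
      ∀ T : SPTree (gridGraph n).edgeSet, T.IsRefutation (tseitin (gridGraph n) ω) →
        c * (n : ℝ) ^ (1.04 : ℝ) ≤ (T.length : ℝ)) ∧
    (∃ c : ℝ, 0 < c ∧ ∀ᶠ n : ℕ in atTop,
      ∀ ω : Fin n × Fin n → ZMod 2, ∑ v, ω v = 1 →
      ∀ T : SPTree (gridGraph n).edgeSet, T.IsRefutation (tseitin (gridGraph n) ω) →
        c * Real.log (n : ℝ) ≤ (T.depth : ℝ)) := by
  refine ⟨⟨1 / 2, by norm_num, ?_⟩, ⟨1, one_pos, ?_⟩⟩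
  · filter_upwards [eventually_ge_atTop 4] with n hn ω _ T hT
    have h1 : (n : ℝ) ^ 2 ≤ T.length + 2 * n := by exact_mod_cast sq_le_length_add_two_mul hT
    have hn' : (4 : ℝ) ≤ n := by exact_mod_cast hn
    have h2 : (n : ℝ) ^ (1.04 : ℝ) ≤ (n : ℝ) ^ 2 := by
      rw [← Real.rpow_natCast]
      exact Real.rpow_le_rpow_of_exponent_le (by linarith) (by norm_num)
    nlinarith
  · filter_upwards [eventually_ge_atTop 4] with n hn ω _ T hT
    have h1 := sq_le_length_add_two_mul hT
    have h2 : n ≤ 2 ^ T.depth := by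
      have := T.length_lt_two_pow_depth
      nlinarith
    have h3 : Real.log n ≤ T.depth * Real.log 2 := by
      rw [← Real.log_pow]
      exact Real.log_le_log (by exact_mod_cast (by omega : 0 < n)) (by exact_mod_cast h2)
    have h4 : Real.log 2 ≤ 1 := by linarith [Real.log_two_lt_d9]
    nlinarith [(Nat.cast_nonneg T.depth : (0 : ℝ) ≤ T.depth)]
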